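/- Let $G=(V,E)$ be a finite connected graph without loops, possibly with multiple edges, and with at least one edge. Let $\mathrm{Bip}\,G$ be the bipartite graph with node set $V\sqcup E$ (elements of $V$ are called violet nodes, elements of $E$ emerald nodes) in which $v\in V$ and $e\in E$ are joined exactly when $v$ is an endpoint of $e$; thus every $e\in E$ has degree $2$. Fix a ribbon structure on $\mathrm{Bip}\,G$, i.e. for each node $x$ a cyclic permutation of the edges incident to $x$, where $xy^+$ denotes the edge following $xy$ at $x$; fix also a base node $b_0\in V\sqcup E$ and a base edge $b_0b_1$ incident to it. For a spanning tree $T$ of $\mathrm{Bip}\,G$, the tour of $T$ is the following sequence of pairs (current node, current edge): it starts with $(b_0,b_0b_1)$; the pair $(x,xy)$ is followed by $(y,yx^+)$ if $xy\in T$ and by $(x,xy^+)$ if $xy\notin T$; it stops right before $(b_0,b_0b_1)$ would occur again. (Each incident node-edge pair occurs exactly once.) Write $<_T$ for the order of the pairs in the tour. The tree $T$ is a $V$-cut Jaeger tree if $(v,ve)<_T(e,ve)$ for every edge $ve\notin T$ of $\mathrm{Bip}\,G$ with $v\in V$, $e\in E$. The violet $T$-order on the edges of $\mathrm{Bip}\,G$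 is given by $ve<v'e'$ if and only if $(v,ve)<_T(v',v'e')$ (with $v,v'\in V$ and $e,e'\in E$); the violet $T$-orders on $V$ and on $E$ compare nodes by their smallest incident edges in this order. An edge $\varepsilon\in T$ is internally semi-passive with respect to a total order of the edges of $\mathrm{Bip}\,G$ if $\varepsilon$ and $\varepsilon'$ have endpoints of different color in each component of $T-\varepsilon$, where $\varepsilon'$ is the smallest among the edges of $\mathrm{Bip}\,G$ that join the two components of $T-\varepsilon$. For $A\in\{V,E\}$, a hypertree on $A$ is a vector $\mathbf f\colon A\to\mathbf Z_{\ge 0}$ for which $\mathrm{Bip}\,G$ has a spanning tree of degree $\mathbf f(a)+1$ at each $a\in A$; let $\mathbf f_A(T)$ be the hypertree with $\mathbf f_A(T)(a)=d_T(a)-1$. Given a total order on $A$, an element $a\in A$ is internally inactive for a hypertree $\mathbf f$ if there is an element $b<a$ of $A$ such that decreasing $\mathbf f(a)$ by $1$ and increasing $\mathbf f(b)$ by $1$ results in another hypertree. Theorem. Let $T$ be a $V$-cut Jaeger tree of $\mathrm{Bip}\,G$. Let $S$ be the set of edges of $T$ that are internally semi-passive with respect to the violet $T$-order of the edges, let $I_V\subseteq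 V$ be the set of internally inactive elements for $\mathbf f_V(T)$ with respect to the violet $T$-order on $V$, and let $I_E\subseteq E$ be the set of internally inactive elements for $\mathbf f_E(T)$ with respect to the violet $T$-order on $E$. Then $S$ is a perfect matching between $I_V$ and $I_E$: sending each edge in $S$ to its violet endpoint is a bijection $S\to I_V$, and sending each edge in $S$ to its emerald endpoint is a bijection $S\to I_E$. -/

import Mathlib

namespace RibbonTour

/-- A hypergraph with vertex set `V` and hyperedges indexed by `E`; distinct indices may carry the
same set, so the hyperedges form a multiset of non-empty subsets of `V`. -/
structure MultiHypergraph (V E : Type*) where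
  /-- the set of vertices contained in a hyperedge -/
  hyperedge : E → Finset V
  nonempty : ∀ e, (hyperedge e).Nonempty

/-- The underlying bipartite graph `Bip H`: its violet nodes are `Sum.inl v`, its emerald nodes are
`Sum.inr e`, and `v` is joined to `e` exactly when `v` lies in the hyperedge `e`. -/
def MultiHypergraph.bip {V E : Type*} (H : MultiHypergraph V E) : SimpleGraph (V ⊕ E) where
  Adj x y := (∃ v e, v ∈ H.hyperedge e ∧ x = Sum.inl v ∧ y = Sum.inr e) ∨
    (∃ v e, v ∈ H.hyperedge e ∧ x = Sum.inr e ∧ y = Sum.inl v)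
  symm := ⟨by
    rintro x y (⟨v, e, h, rfl, rfl⟩ | ⟨v, e, h, rfl, rfl⟩)
    · exact Or.inr ⟨v, e, h, rfl, rfl⟩
    · exact Or.inl ⟨v, e, h, rfl, rfl⟩⟩
  loopless := ⟨by
    rintro x (⟨v, e, _, rfl, h⟩ | ⟨v, e, _, rfl, h⟩) <;> simp at h⟩

/-- `H` is an ordinary loopless graph, possibly with multiple edges. -/
def MultiHypergraph.IsGraph {V E : Type*} (H : MultiHypergraph V E) : Prop :=
  ∀ e, (H.hyperedge e).card = 2

/-- A ribbon structure: at each node, a permutation of the incident edges (given by their other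
endpoints) which is one single cycle. -/
structure RibbonStructure {N : Type*} (G : SimpleGraph N) where
  rot : ∀ x : N, Equiv.Perm (G.neighborSet x)
  isCycle : ∀ x : N, (rot x).IsCycleOn Set.univ

/-- The node-edge pair `(x, xy)` is the dart from `x` to `y`; this is the pair `(x, xy⁺)`, where
`xy⁺` is the edge following `xy` at `x`. -/
def RibbonStructure.next {N : Type*} {G : SimpleGraph N} (R : RibbonStructure G)
    (d : G.Dart) : G.Dart where
  fst := d.fst
  snd := (R.rot d.fst ⟨d.snd, d.adj⟩ : G.neighborSet d.fst)
  adj := (R.rot d.fst ⟨d.snd, d.adj⟩).2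

open Classical in
/-- One step of the tour of `T`: from `(x, xy)` go to `(y, yx⁺)` if `xy ∈ T` (the edge is
traversed), and to `(x, xy⁺)` if not (the edge is skipped). -/
noncomputable def RibbonStructure.step {N : Type*} {G : SimpleGraph N} (R : RibbonStructure G)
    (T : SimpleGraph N) (d : G.Dart) : G.Dart :=
  if T.Adj d.fst d.snd then R.next d.symm else R.next d

/-- The tour of `T` starts at the pair `base = (b₀, b₀b₁)` and stops right before this pair would
become current again. `TourLt R base T c c'` says that the pair `c` comes before `c'` in the tour,
where `c = (x, y)` stands for the node-edge pair `(x, xy)`. -/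
def TourLt {N : Type*} {G : SimpleGraph N} (R : RibbonStructure G) (base : G.Dart)
    (T : SimpleGraph N) (c c' : N × N) : Prop :=
  ∃ i j : ℕ, i < j ∧ j < Function.minimalPeriod (R.step T) base ∧
    ((R.step T)^[i] base).toProd = c ∧ ((R.step T)^[j] base).toProd = c'

/-- `T` is (the edge set of) a spanning tree of `G`. -/
def IsSpanningTree {N : Type*} (G T : SimpleGraph N) : Prop :=
  T ≤ G ∧ T.IsTree

section Bipartite

variable {V E : Type*} {G : SimpleGraph (V ⊕ E)}

/-- `T` is a `V`-cut Jaeger tree: a spanning tree in whose tour each non-edge of `T` is met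
first at its violet endpoint. -/
def IsVCutJaegerTree (R : RibbonStructure G) (base : G.Dart) (T : SimpleGraph (V ⊕ E)) : Prop :=
  IsSpanningTree G T ∧ ∀ (v : V) (e : E), G.Adj (Sum.inl v) (Sum.inr e) →
    ¬ T.Adj (Sum.inl v) (Sum.inr e) →
      TourLt R base T (Sum.inl v, Sum.inr e) (Sum.inr e, Sum.inl v)

/-- The violet `T`-order of edges: the order in which the edges appear in the tour of `T` with
their violet endpoint as current node. The pair `(v, e)` stands for the edge `ve`. -/
def VioletEdgeLt (R : RibbonStructure G) (base : G.Dart) (T : SimpleGraph (V ⊕ E))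
    (p q : V × E) : Prop :=
  TourLt R base T (Sum.inl p.1, Sum.inr p.2) (Sum.inl q.1, Sum.inr q.2)

/-- The violet `T`-order on `V`: nodes are compared by their smallest incident edges. -/
def VioletLtOnV (R : RibbonStructure G) (base : G.Dart) (T : SimpleGraph (V ⊕ E))
    (v v' : V) : Prop :=
  ∃ e, G.Adj (Sum.inl v) (Sum.inr e) ∧
    ∀ e', G.Adj (Sum.inl v') (Sum.inr e') → VioletEdgeLt R base T (v, e) (v', e')

/-- The violet `T`-order on `E`: nodes are compared by their smallest incident edges. -/
def VioletLtOnE (R : RibbonStructure G) (base : G.Dart) (T : SimpleGraph (V ⊕ E))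
    (e e' : E) : Prop :=
  ∃ v, G.Adj (Sum.inl v) (Sum.inr e) ∧
    ∀ v', G.Adj (Sum.inl v') (Sum.inr e') → VioletEdgeLt R base T (v, e) (v', e')

/-- The base cut `C*(T, ε)` for `ε = p`: the edges of `G` joining different components
of `T - ε`. -/
def baseCut (G T : SimpleGraph (V ⊕ E)) (p : V × E) : Set (V × E) :=
  {q | G.Adj (Sum.inl q.1) (Sum.inr q.2) ∧
    ¬ (T.deleteEdges {s(Sum.inl p.1, Sum.inr p.2)}).Reachable (Sum.inl q.1) (Sum.inr q.2)}

/-- The edges `p` and `q` stand opposite in `T - p`: each component of `T - p` that contains an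
endpoint of one of them contains an endpoint of the other, of the other color. -/
def StandOpposite (T : SimpleGraph (V ⊕ E)) (p q : V × E) : Prop :=
  (T.deleteEdges {s(Sum.inl p.1, Sum.inr p.2)}).Reachable (Sum.inl p.1) (Sum.inr q.2) ∧
  (T.deleteEdges {s(Sum.inl p.1, Sum.inr p.2)}).Reachable (Sum.inr p.2) (Sum.inl q.1)

/-- The edge `p` of the spanning tree `T` of `G` is internally semi-passive with respect to the
order `lt` of the edges: it stands opposite to the smallest edge of its base cut. -/
def IsInternallySemiPassive (G T : SimpleGraph (V ⊕ E)) (lt : V × E → V × E → Prop)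
    (p : V × E) : Prop :=
  T.Adj (Sum.inl p.1) (Sum.inr p.2) ∧
    ∃ q ∈ baseCut G T p, (∀ q' ∈ baseCut G T p, q' ≠ q → lt q q') ∧ StandOpposite T p q

end Bipartite

section Hypertree

variable {N A : Type*}

/-- The vector `f(a) = d_T(a) - 1` on a class `A` of nodes (embedded by `ι`). The subtraction is
not truncated when `T` is a tree with at least two nodes. -/
noncomputable def inducedHypertree (ι : A → N) (T : SimpleGraph N) (a : A) : ℕ :=
  (T.neighborSet (ι a)).ncard - 1

/-- `f` is a hypertree on the class `A` of nodes of `G`: some spanning tree of `G` has degree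
`f(a) + 1` at each `a`. -/
def IsHypertree (G : SimpleGraph N) (ι : A → N) (f : A → ℕ) : Prop :=
  ∃ T : SimpleGraph N, IsSpanningTree G T ∧ ∀ a, (T.neighborSet (ι a)).ncard = f a + 1

/-- `f` is such that `a` can transfer valence to `b`: lowering the value at `a` by one and raising
the value at `b` by one gives a hypertree. -/
def CanTransfer (G : SimpleGraph N) (ι : A → N) (f : A → ℕ) (a b : A) : Prop :=
  ∃ g : A → ℕ, IsHypertree G ι g ∧ g a + 1 = f a ∧ g b = f b + 1 ∧
    ∀ c, c ≠ a → c ≠ b → g c = f c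

/-- `a` is internally active for `f`: it cannot transfer valence to any smaller element. -/
def IsInternallyActive (G : SimpleGraph N) (ι : A → N) (lt : A → A → Prop) (f : A → ℕ)
    (a : A) : Prop :=
  ∀ b, lt b a → ¬ CanTransfer G ι f a b

/-- The set of internally inactive elements for `f`. -/
def internallyInactive (G : SimpleGraph N) (ι : A → N) (lt : A → A → Prop) (f : A → ℕ) : Set A :=
  {a | ¬ IsInternallyActive G ι lt f a}

end Hypertree

end RibbonTour

/-! The tour behaves like a depth-first walk around `T`: if a tree edge is first traversed from `x`
to `y`, then the pairs whose node lies on the side of `y` are exactly those after `(x, xy)` and up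
to `(y, yx)` (`mem_farSide_iff`).

This makes semi-passivity concrete. Let `U` be the component of `u` in `T - ue`. A tree edge `ue` is
semi-passive iff the tour first traverses it from `e` to `u` and some edge `vf` of `G` has `v`
outside `U` and `f` in `U` (`IsVCutJaegerTree.isInternallySemiPassive_iff`). By the Jaeger condition
such a `vf` is seen at `v` before `U` is entered, hence before every edge with violet end in `U`.
Exchanging `ue` for `vf` transfers valence from `u` to `v < u` and from `e` to `f < e`, so both ends
of `ue` are inactive.

Violet half: `u` is entered for the first time by only one tree edge, which gives injectivity. If
`u` can transfer to `w < u`, let `ue` be that entering edge. If it were not semi-passive, the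
complement of `U` would contain all neighbors of its violet nodes. There `T` is connected, while a
tree realizing the transfer is a forest with violet degrees at least as large, and strictly larger
at `w`; counting edges excludes this.

Emerald half: as `e` has only two neighbors `u`, `v`, the pair `(e, eu)` comes right after `(v, ve)`
if both edges are in `T` and `e` is entered from `v`. If `e` can transfer to `f < e` and `ue` were
not semi-passive, both ends of `f` would lie outside `U`. A tree realizing the transfer would then
have no emerald node linking the violet nodes of `U` to the others, so it would be disconnected. -/

namespace RibbonTour

/-! ### The tour of a spanning tree and the two sides of a tree edge -/

section Tour

variable {N : Type*} {G T : SimpleGraph N}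

/-- The component of `y` after the deletion of the edge `xy` from `T`. -/
def farSide (T : SimpleGraph N) (x y : N) : Set N :=
  {z | (T.deleteEdges {s(x, y)}).Reachable y z}

theorem mem_farSide_self (T : SimpleGraph N) (x y : N) : y ∈ farSide T x y :=
  SimpleGraph.Reachable.refl _

theorem notMem_farSide (hT : T.IsTree) {x y : N} (h : T.Adj x y) : x ∉ farSide T x y := fun hx ↦
  SimpleGraph.isAcyclic_iff_forall_adj_isBridge.1 hT.isAcyclic h (SimpleGraph.Reachable.symm hx)

theorem mem_farSide_of_adj {x y a b : N} (ha : a ∈ farSide T x y) (h : T.Adj a b)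
    (hne : s(a, b) ≠ s(x, y)) : b ∈ farSide T x y :=
  SimpleGraph.Reachable.trans ha
    (SimpleGraph.Adj.reachable (SimpleGraph.deleteEdges_adj.2 ⟨h, by simpa using hne⟩))

theorem eq_of_mem_farSide_of_notMem (hT : T.IsTree) {x y a b : N} (hxy : T.Adj x y)
    (h : T.Adj a b) (ha : a ∈ farSide T x y) (hb : b ∉ farSide T x y) : (a, b) = (y, x) := by
  have h1 : s(a, b) = s(x, y) := by
    by_contra hne
    exact hb (mem_farSide_of_adj ha h hne)
  rcases Sym2.eq_iff.1 h1 with ⟨rfl, rfl⟩ | ⟨rfl, rfl⟩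
  · exact absurd ha (notMem_farSide hT hxy)
  · rfl

theorem mem_farSide_symm_iff (hT : T.IsTree) {x y z : N} (hxy : T.Adj x y) :
    z ∈ farSide T y x ↔ z ∉ farSide T x y := by
  constructor
  · intro h1 h2
    refine notMem_farSide hT hxy (SimpleGraph.Reachable.trans h2 (SimpleGraph.Reachable.symm ?_))
    have : s(y, x) = s(x, y) := Sym2.eq_swap
    rwa [farSide, this] at h1
  · obtain ⟨p⟩ := hT.connected.preconnected y z
    intro hz
    by_contra hz'
    have key : ∀ (a b : N) (_ : T.Walk a b), (a ∈ farSide T x y ∨ a ∈ farSide T y x) →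
        (b ∈ farSide T x y ∨ b ∈ farSide T y x) := by
      intro a b p
      induction p with
      | nil => exact id
      | @cons a c b h p ih =>
        refine fun ha ↦ ih ?_
        by_cases hac : s(a, c) = s(x, y)
        · rcases Sym2.eq_iff.1 hac with ⟨rfl, rfl⟩ | ⟨rfl, rfl⟩
          · exact Or.inl (mem_farSide_self _ _ _)
          · exact Or.inr (mem_farSide_self _ _ _)
        · exact ha.imp (fun ha ↦ mem_farSide_of_adj ha h hac)
            (fun ha ↦ mem_farSide_of_adj ha h (by rwa [Sym2.eq_swap (a := y)]))
    exact (key _ _ p (Or.inl (mem_farSide_self _ _ _))).elim hz hz'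

theorem mem_farSide_iff_of_adj {x y a b : N} (h : T.Adj a b)
    (hne : s(a, b) ≠ s(x, y)) : a ∈ farSide T x y ↔ b ∈ farSide T x y :=
  ⟨fun ha ↦ mem_farSide_of_adj ha h hne,
    fun hb ↦ mem_farSide_of_adj hb h.symm (by rwa [Sym2.eq_swap])⟩

variable (R : RibbonStructure G)

theorem RibbonStructure.next_injective : Function.Injective R.next := by
  rintro ⟨⟨x, y⟩, h⟩ ⟨⟨x', y'⟩, h'⟩ he
  have h1 : x = x' := congrArg (fun d : G.Dart ↦ d.fst) he
  subst h1
  have h2 : (R.rot x ⟨y, h⟩ : N) = R.rot x ⟨y', h'⟩ := congrArg (fun d : G.Dart ↦ d.snd) he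
  have h3 := (R.rot x).injective (Subtype.ext h2)
  replace h3 : y = y' := congrArg Subtype.val h3
  subst h3
  rfl

theorem RibbonStructure.step_of_adj {d : G.Dart} (h : T.Adj d.fst d.snd) :
    R.step T d = R.next d.symm := if_pos h

theorem RibbonStructure.step_of_not_adj {d : G.Dart} (h : ¬ T.Adj d.fst d.snd) :
    R.step T d = R.next d := if_neg h

theorem RibbonStructure.step_injective (T : SimpleGraph N) :
    Function.Injective (R.step T) := by
  intro d d' he
  by_cases h : T.Adj d.fst d.snd <;> by_cases h' : T.Adj d'.fst d'.snd
  · rw [R.step_of_adj h, R.step_of_adj h'] at he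
    exact SimpleGraph.Dart.symm_involutive.injective (R.next_injective he)
  · rw [R.step_of_adj h, R.step_of_not_adj h'] at he
    rw [← R.next_injective he] at h'
    exact absurd h.symm h'
  · rw [R.step_of_not_adj h, R.step_of_adj h'] at he
    rw [R.next_injective he] at h
    exact absurd h'.symm h
  · rw [R.step_of_not_adj h, R.step_of_not_adj h'] at he
    exact R.next_injective he

theorem RibbonStructure.iterate_step_fst_mem {K : Set N} {c : N × N}
    (hK : ∀ z w, T.Adj z w → z ∈ K → w ∉ K → (z, w) = c) {d : G.Dart} (hd : d.fst ∈ K) (n : ℕ)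
    (hn : ∀ i < n, ((R.step T)^[i] d).toProd ≠ c) : ((R.step T)^[n] d).fst ∈ K := by
  induction n with
  | zero => exact hd
  | succ n ih =>
    have ih := ih fun i hi ↦ hn i (by omega)
    rw [Function.iterate_succ_apply']
    generalize hd' : (R.step T)^[n] d = d' at ih
    by_cases h : T.Adj d'.fst d'.snd
    · rw [R.step_of_adj h]
      by_contra hcon
      exact hn n (by omega) (by rw [hd']; exact hK _ _ h ih hcon)
    · rw [R.step_of_not_adj h]
      exact ih

variable [Finite N]

instance finite_dart : Finite G.Dart :=
  Finite.of_injective (fun d : G.Dart ↦ d.toProd) fun _ _ h ↦ SimpleGraph.Dart.ext _ _ h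

/-- The orbit of the base pair is closed under reversing tree edges and under rotation at a node,
and `T` connects all nodes. -/
theorem RibbonStructure.exists_iterate_step_eq (hT : IsSpanningTree G T) (base d : G.Dart) :
    ∃ i, (R.step T)^[i] base = d := by
  let O : Set G.Dart := {d | ∃ i, (R.step T)^[i] base = d}
  have hstep : ∀ d ∈ O, R.step T d ∈ O := by
    rintro _ ⟨i, rfl⟩
    exact ⟨i + 1, Function.iterate_succ_apply' _ _ _⟩
  have hiter : ∀ d ∈ O, ∀ n, (R.step T)^[n] d ∈ O := by
    rintro _ ⟨i, rfl⟩ n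
    exact ⟨n + i, Function.iterate_add_apply _ _ _ _⟩
  have hsymm : ∀ d ∈ O, T.Adj d.fst d.snd → d.symm ∈ O := by
    intro d hd h
    obtain ⟨m, hm, hper⟩ := (R.step_injective T).mem_periodicPts d
    obtain ⟨n, rfl⟩ : ∃ n, m = n + 1 := ⟨m - 1, by omega⟩
    -- Having crossed to the far side, the periodic tour must come back to `d`, and the reverse of
    -- `d` is the only way back.
    by_contra hcon
    have := R.iterate_step_fst_mem (T := T) (K := farSide T d.fst d.snd) (c := (d.snd, d.fst))
      (fun z w hzw hz hw ↦ eq_of_mem_farSide_of_notMem hT.2 h hzw hz hw) (d := R.step T d)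
      (by rw [R.step_of_adj h]; exact mem_farSide_self _ _ _) n (by
        intro i _ hi
        refine hcon ?_
        rw [show d.symm = (R.step T)^[i] (R.step T d) from SimpleGraph.Dart.ext _ _ hi.symm]
        exact hiter _ (hstep _ hd) i)
    rw [← Function.iterate_succ_apply, hper] at this
    exact notMem_farSide hT.2 h this
  have hnext : ∀ d ∈ O, R.next d ∈ O := by
    intro d hd
    by_cases h : T.Adj d.fst d.snd
    · have h1 := hstep _ (hsymm d hd h)
      rwa [R.step_of_adj (d := d.symm) h.symm, SimpleGraph.Dart.symm_symm] at h1
    · rw [← R.step_of_not_adj h]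
      exact hstep _ hd
  have hnode : ∀ x y z (hy : G.Adj x y) (hz : G.Adj x z), (⟨(x, y), hy⟩ : G.Dart) ∈ O →
      (⟨(x, z), hz⟩ : G.Dart) ∈ O := by
    intro x y z hy hz hO
    obtain ⟨n, hn⟩ := (R.isCycle x).exists_pow_eq' (Set.toFinite _)
      (Set.mem_univ (⟨y, hy⟩ : G.neighborSet x)) (Set.mem_univ ⟨z, hz⟩)
    have : ∀ n : ℕ, (⟨(x, ((R.rot x ^ n) ⟨y, hy⟩ : G.neighborSet x)),
        ((R.rot x ^ n) ⟨y, hy⟩).2⟩ : G.Dart) ∈ O := by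
      intro n
      induction n with
      | zero => exact hO
      | succ n ih =>
        have := hnext _ ih
        simp only [RibbonStructure.next] at this
        simpa only [pow_succ', Equiv.Perm.mul_apply] using this
    have h2 := this n
    simpa only [hn] using h2
  have hwalk : ∀ (a b : N) (_ : T.Walk a b), (∀ z (hz : G.Adj a z), (⟨(a, z), hz⟩ : G.Dart) ∈ O) →
      ∀ z (hz : G.Adj b z), (⟨(b, z), hz⟩ : G.Dart) ∈ O := by
    intro a b p
    induction p with
    | nil => exact id
    | @cons a c b h p ih =>
      refine fun ha ↦ ih fun z hz ↦ ?_
      exact hnode c a z (hT.1 h).symm hz (hsymm _ (ha c (hT.1 h)) h)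
  obtain ⟨p⟩ := hT.2.connected.preconnected base.fst d.fst
  exact hwalk _ _ p (fun z hz ↦ hnode _ _ _ base.adj hz ⟨0, rfl⟩) _ d.adj

/-- The time at which the node-edge pair `(x, xy)` is current in the tour of `T`. -/
noncomputable def tourPos (R : RibbonStructure G) (base : G.Dart) (T : SimpleGraph N)
    (x y : N) : ℕ :=
  sInf {i | ((R.step T)^[i] base).toProd = (x, y)}

variable {R} {base : G.Dart}

theorem iterate_tourPos (hT : IsSpanningTree G T) {x y : N} (h : G.Adj x y) :
    ((R.step T)^[tourPos R base T x y] base).toProd = (x, y) := by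
  obtain ⟨i, hi⟩ := R.exists_iterate_step_eq hT base ⟨(x, y), h⟩
  exact Nat.sInf_mem (s := {i | ((R.step T)^[i] base).toProd = (x, y)})
    ⟨i, congrArg SimpleGraph.Dart.toProd hi⟩

theorem minimalPeriod_step_pos (R : RibbonStructure G) (base : G.Dart) (T : SimpleGraph N) :
    0 < Function.minimalPeriod (R.step T) base :=
  Function.minimalPeriod_pos_of_mem_periodicPts ((R.step_injective T).mem_periodicPts base)

theorem tourPos_lt (hT : IsSpanningTree G T) {x y : N} (h : G.Adj x y) :
    tourPos R base T x y < Function.minimalPeriod (R.step T) base := by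
  refine lt_of_le_of_lt (Nat.sInf_le ?_)
    (Nat.mod_lt (tourPos R base T x y) (minimalPeriod_step_pos R base T))
  rw [Set.mem_ofPred_eq, Function.iterate_mod_minimalPeriod_eq, iterate_tourPos hT h]

theorem tourPos_eq (hT : IsSpanningTree G T) {i : ℕ} {x y : N}
    (hi : i < Function.minimalPeriod (R.step T) base)
    (h : ((R.step T)^[i] base).toProd = (x, y)) : tourPos R base T x y = i := by
  have hxy : G.Adj x y := by
    have := ((R.step T)^[i] base).adj
    rwa [h] at this
  refine Function.iterate_injOn_Iio_minimalPeriod (f := R.step T) (x := base)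
    (tourPos_lt hT hxy) hi (SimpleGraph.Dart.ext _ _ ?_)
  rw [iterate_tourPos hT hxy, h]

theorem tourPos_inj (hT : IsSpanningTree G T) {x y z w : N} (h : G.Adj x y) (h' : G.Adj z w)
    (he : tourPos R base T x y = tourPos R base T z w) : x = z ∧ y = w := by
  have h1 := iterate_tourPos (R := R) (base := base) hT h
  rw [he, iterate_tourPos hT h'] at h1
  simpa [eq_comm] using h1

theorem tourLt_iff (hT : IsSpanningTree G T) {x y z w : N} (h : G.Adj x y) (h' : G.Adj z w) :
    TourLt R base T (x, y) (z, w) ↔ tourPos R base T x y < tourPos R base T z w := by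
  constructor
  · rintro ⟨i, j, hij, hj, hi', hj'⟩
    rwa [tourPos_eq hT (hij.trans hj) hi', tourPos_eq hT hj hj']
  · exact fun hlt ↦ ⟨_, _, hlt, tourPos_lt hT h', iterate_tourPos hT h, iterate_tourPos hT h'⟩

theorem tourPos_base (hT : IsSpanningTree G T) : tourPos R base T base.fst base.snd = 0 :=
  tourPos_eq hT (minimalPeriod_step_pos R base T) rfl

/-- The last clause holds because a rotation that is a single cycle on at least two edges fixes none
of them. -/
theorem exists_tourPos_eq_add_one (hT : IsSpanningTree G T) {x y : N} (h : T.Adj x y)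
    (hlt : tourPos R base T x y + 1 < Function.minimalPeriod (R.step T) base) :
    ∃ z, G.Adj y z ∧ tourPos R base T y z = tourPos R base T x y + 1 ∧
      ∀ w, G.Adj y w → w ≠ x → z ≠ x := by
  have hd := iterate_tourPos (R := R) (base := base) hT (hT.1 h)
  have hs : R.step T ((R.step T)^[tourPos R base T x y] base) =
      R.next (⟨(x, y), hT.1 h⟩ : G.Dart).symm := by
    rw [show (R.step T)^[tourPos R base T x y] base = ⟨(x, y), hT.1 h⟩ from
      SimpleGraph.Dart.ext _ _ hd, R.step_of_adj (d := ⟨(x, y), hT.1 h⟩) h]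
  refine ⟨R.rot y ⟨x, (hT.1 h).symm⟩, (R.rot y ⟨x, (hT.1 h).symm⟩).2, tourPos_eq hT hlt ?_, ?_⟩
  · rw [Function.iterate_succ_apply', hs]
    rfl
  · intro w hw hwx he
    refine (R.isCycle y).apply_ne ?_ (Set.mem_univ ⟨x, (hT.1 h).symm⟩) (Subtype.ext he)
    exact ⟨⟨w, hw⟩, Set.mem_univ _, ⟨x, (hT.1 h).symm⟩, Set.mem_univ _,
      fun h ↦ hwx (congrArg Subtype.val h)⟩

theorem exists_tourPos_add_one_eq (hT : IsSpanningTree G T) {a b : N} (h : G.Adj a b)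
    (hpos : 0 < tourPos R base T a b) :
    ∃ x y, G.Adj x y ∧ tourPos R base T x y + 1 = tourPos R base T a b ∧
      ((T.Adj x y ∧ y = a) ∨ (¬ T.Adj x y ∧ x = a)) := by
  obtain ⟨n, hn⟩ : ∃ n, tourPos R base T a b = n + 1 := ⟨_, (Nat.succ_pred_eq_of_pos hpos).symm⟩
  have hlt := tourPos_lt (R := R) (base := base) hT h
  have hit := iterate_tourPos (R := R) (base := base) hT h
  rw [hn, Function.iterate_succ_apply'] at hit
  refine ⟨((R.step T)^[n] base).fst, ((R.step T)^[n] base).snd, ((R.step T)^[n] base).adj, ?_, ?_⟩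
  · rw [hn, tourPos_eq hT (i := n) (by omega) rfl]
  · generalize (R.step T)^[n] base = d at hit
    by_cases hd : T.Adj d.fst d.snd
    · rw [R.step_of_adj hd] at hit
      exact Or.inl ⟨hd, congrArg Prod.fst hit⟩
    · rw [R.step_of_not_adj hd] at hit
      exact Or.inr ⟨hd, congrArg Prod.fst hit⟩

/-- As long as the tour does not use the pair `c` by which alone it can leave `K`, it stays in
`K`. -/
theorem mem_of_tourPos_le (hT : IsSpanningTree G T) {K : Set N} {c c' : N}
    (hK : ∀ z w, T.Adj z w → z ∈ K → w ∉ K → (z, w) = (c, c'))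
    {x y a b : N} (hxy : G.Adj x y) (hab : G.Adj a b) (hx : x ∈ K)
    (hle : tourPos R base T x y ≤ tourPos R base T a b)
    (hout : tourPos R base T c c' < tourPos R base T x y ∨
      tourPos R base T a b ≤ tourPos R base T c c') : a ∈ K := by
  obtain ⟨n, hn⟩ := Nat.exists_eq_add_of_le hle
  have h1 := iterate_tourPos (R := R) (base := base) hT hxy
  have h2 := iterate_tourPos (R := R) (base := base) hT hab
  have hlt := tourPos_lt (R := R) (base := base) hT hab
  have := R.iterate_step_fst_mem hK
    (d := (R.step T)^[tourPos R base T x y] base) (by rw [h1]; exact hx) n (by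
      intro i hi hc'
      rw [← Function.iterate_add_apply] at hc'
      have := tourPos_eq hT (by omega) hc'
      omega)
  rw [← Function.iterate_add_apply, add_comm, ← hn, h2] at this
  exact this

/-- If the tree edge `xy` is first traversed from `x` to `y`, then the tour is on the side of `y`
exactly between the two traversals. -/
theorem mem_farSide_iff (hT : IsSpanningTree G T) {x y : N} (h : T.Adj x y)
    (hlt : tourPos R base T x y < tourPos R base T y x) {a b : N} (hab : G.Adj a b) :
    a ∈ farSide T x y ↔
      tourPos R base T x y < tourPos R base T a b ∧ tourPos R base T a b ≤ tourPos R base T y x := by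
  have hG := hT.1 h
  have hfar : ∀ z w, T.Adj z w → z ∈ farSide T x y → w ∉ farSide T x y → (z, w) = (y, x) :=
    fun z w hzw hz hw ↦ eq_of_mem_farSide_of_notMem hT.2 h hzw hz hw
  have hnear : ∀ z w, T.Adj z w → z ∈ (farSide T x y)ᶜ → w ∉ (farSide T x y)ᶜ →
      (z, w) = (x, y) := by
    intro z w hzw hz hw
    have := hfar w z hzw.symm (not_not.1 hw) hz
    simp_all
  -- Starting on the far side, the tour could reach `x` only after using `(y, x)`, which comes later
  -- than `(x, y)`.
  have hb : base.fst ∉ farSide T x y := by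
    intro hb
    refine notMem_farSide hT.2 h (mem_of_tourPos_le (R := R) (base := base) hT hfar
      base.adj hG hb ?_ (Or.inr hlt.le))
    rw [tourPos_base hT]
    exact Nat.zero_le _
  rcases le_or_gt (tourPos R base T a b) (tourPos R base T x y) with h1 | h1
  · refine iff_of_false ?_ (by omega)
    refine mem_of_tourPos_le (R := R) (base := base) (K := (farSide T x y)ᶜ) hT hnear
      base.adj hab hb ?_ (Or.inr h1)
    rw [tourPos_base hT]
    exact Nat.zero_le _
  obtain ⟨z, hz, hz', -⟩ := exists_tourPos_eq_add_one (R := R) (base := base) hT h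
    (by have := tourPos_lt (R := R) (base := base) hT hG.symm; omega)
  rcases le_or_gt (tourPos R base T a b) (tourPos R base T y x) with h2 | h2
  · refine iff_of_true ?_ ⟨h1, h2⟩
    exact mem_of_tourPos_le (R := R) (base := base) hT hfar hz hab
      (mem_farSide_self _ _ _) (by omega) (Or.inr h2)
  · refine iff_of_false ?_ (by omega)
    have hlt' : tourPos R base T y x + 1 < Function.minimalPeriod (R.step T) base := by
      have := tourPos_lt (R := R) (base := base) hT hab; omega
    obtain ⟨w, hw, hw', -⟩ := exists_tourPos_eq_add_one (R := R) (base := base) hT h.symm hlt'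
    exact mem_of_tourPos_le (R := R) (base := base) (K := (farSide T x y)ᶜ) hT hnear hw hab
      (notMem_farSide hT.2 h) (by omega) (Or.inl (by omega))

/-- A node has at most one parent: of two tree edges both first traversed towards `y`, each would
have to be traversed before the other, since its start lies on the far side of the other. -/
theorem tourPos_lt_of_ne (hT : IsSpanningTree G T) {x x' y : N} (h : T.Adj x y) (h' : T.Adj x' y)
    (hne : x ≠ x') (hlt : tourPos R base T x y < tourPos R base T y x) :
    tourPos R base T y x' < tourPos R base T x' y := by
  by_contra hcon
  have hlt' : tourPos R base T x' y < tourPos R base T y x' := by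
    refine lt_of_le_of_ne (not_lt.1 hcon) fun he ↦ ?_
    exact h'.ne (tourPos_inj hT (hT.1 h') (hT.1 h').symm he).1
  have h1 := (mem_farSide_iff (R := R) (base := base) hT h hlt (hT.1 h')).1
    (mem_farSide_of_adj (mem_farSide_self _ _ _) h'.symm
      (by simp [h.ne.symm, hne.symm]))
  have h2 := (mem_farSide_iff (R := R) (base := base) hT h' hlt' (hT.1 h)).1
    (mem_farSide_of_adj (mem_farSide_self _ _ _) h.symm
      (by simp [h'.ne.symm, hne]))
  omega

end Tour

/-! ### Exchanging a tree edge and transferring valence -/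

section Exchange

variable {N : Type*} {G T : SimpleGraph N}

theorem IsSpanningTree.exchange (hT : IsSpanningTree G T) {a b c d : N} (hab : T.Adj a b)
    (hcd : G.Adj c d) (hc : c ∉ farSide T a b) (hd : d ∈ farSide T a b) :
    IsSpanningTree G (T.deleteEdges {s(a, b)} ⊔ SimpleGraph.edge c d) := by
  set D := T.deleteEdges {s(a, b)} with hD
  have hca : D.Reachable a c := by
    have := (mem_farSide_symm_iff hT.2 hab).2 hc
    rwa [farSide, Set.mem_ofPred_eq, Sym2.eq_swap, ← hD] at this
  have hle : D ≤ D ⊔ SimpleGraph.edge c d := le_sup_left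
  have hcd' : (D ⊔ SimpleGraph.edge c d).Reachable c d :=
    SimpleGraph.Adj.reachable (Or.inr (by simp [SimpleGraph.edge_adj, hcd.ne]))
  refine ⟨sup_le ((SimpleGraph.deleteEdges_le _).trans hT.1) ?_, ⟨?_, ?_⟩⟩
  · rwa [SimpleGraph.edge_le_iff, or_iff_right hcd.ne]
  · have key : ∀ z, (D ⊔ SimpleGraph.edge c d).Reachable c z := by
      intro z
      by_cases hz : z ∈ farSide T a b
      · exact hcd'.trans ((SimpleGraph.Reachable.mono hle hd).symm.trans
          (SimpleGraph.Reachable.mono hle hz))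
      · have := (mem_farSide_symm_iff hT.2 hab).2 hz
        rw [farSide, Set.mem_ofPred_eq, Sym2.eq_swap, ← hD] at this
        exact (hca.mono hle).symm.trans (this.mono hle)
    have : Nonempty N := ⟨c⟩
    exact ⟨fun x y ↦ (key x).symm.trans (key y)⟩
  · refine SimpleGraph.IsAcyclic.sup_edge_of_not_reachable (fun h ↦ hc ?_)
      (hT.2.isAcyclic.anti (SimpleGraph.deleteEdges_le _))
    exact SimpleGraph.Reachable.trans hd h.symm

theorem IsSpanningTree.neighborSet_ncard_pos [Finite N] [Nontrivial N] (hT : IsSpanningTree G T)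
    (x : N) : 0 < (T.neighborSet x).ncard := by
  obtain ⟨y, hy⟩ := hT.2.connected.preconnected.exists_adj_of_nontrivial x
  exact (Set.ncard_pos (Set.toFinite _)).2 ⟨y, hy⟩

/-- Since `m` and `n` are outside the class `A`, the exchange changes degrees within the class only
at `p` and `q`. -/
theorem canTransfer_of_exchange [Finite N] {A : Type*} {ι : A → N}
    (hι : Function.Injective ι) {T' : SimpleGraph N} (hT : IsSpanningTree G T)
    (hT' : IsSpanningTree G T') {p q : A} {m n : N} (hpq : p ≠ q) (hm : m ∉ Set.range ι)
    (hn : n ∉ Set.range ι) (hpm : T.Adj (ι p) m) (hqn : ¬ T.Adj (ι q) n)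
    (hadj : ∀ x y, T'.Adj x y ↔
      (T.Adj x y ∧ s(x, y) ≠ s(ι p, m)) ∨ s(x, y) = s(ι q, n)) :
    CanTransfer G ι (inducedHypertree ι T) p q := by
  have : Nontrivial N := ⟨ι p, m, hpm.ne⟩
  have hne : ι p ≠ ι q := hι.ne hpq
  have hmι : ∀ a, ι a ≠ m := fun a h ↦ hm ⟨a, h⟩
  have hnι : ∀ a, ι a ≠ n := fun a h ↦ hn ⟨a, h⟩
  have h1 : T.neighborSet (ι p) = insert m (T'.neighborSet (ι p)) := by
    ext y
    simp only [Set.mem_insert_iff, SimpleGraph.mem_neighborSet, hadj, Sym2.eq_iff, ne_eq, hne,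
      hnι, hmι, false_and, or_false, true_and]
    by_cases h : y = m
    · simp [h, hpm]
    · simp [h]
  have h2 : T'.neighborSet (ι q) = insert n (T.neighborSet (ι q)) := by
    ext y
    simp [hadj, hne.symm, hnι, hmι, or_comm]
  have h3 : ∀ c, c ≠ p → c ≠ q → T'.neighborSet (ι c) = T.neighborSet (ι c) := by
    intro c hcp hcq
    ext y
    simp [hadj, hι.ne hcp, hι.ne hcq, hnι, hmι]
  have hp := hT'.neighborSet_ncard_pos (ι p)
  have hq := hT.neighborSet_ncard_pos (ι q)
  refine ⟨inducedHypertree ι T', ⟨T', hT', fun a ↦ ?_⟩, ?_, ?_, fun c hcp hcq ↦ ?_⟩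
  · exact (Nat.sub_add_cancel (hT'.neighborSet_ncard_pos _)).symm
  · rw [inducedHypertree, inducedHypertree, h1, Set.ncard_insert_of_notMem]
    · omega
    · simp [hadj, hne, hnι]
  · rw [inducedHypertree, inducedHypertree, h2,
      Set.ncard_insert_of_notMem (show n ∉ T.neighborSet (ι q) from hqn)]
    omega
  · rw [inducedHypertree, inducedHypertree, h3 c hcp hcq]

theorem connected_induce_farSide (T : SimpleGraph N) (x y : N) :
    (T.induce (farSide T x y)).Connected := by
  set D := T.deleteEdges {s(x, y)} with hD
  have key : ∀ (a b : N) (_ : D.Walk a b) (ha : a ∈ farSide T x y),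
      ∃ hb : b ∈ farSide T x y, (T.induce (farSide T x y)).Reachable ⟨a, ha⟩ ⟨b, hb⟩ := by
    intro a b p
    induction p with
    | nil => exact fun ha ↦ ⟨ha, SimpleGraph.Reachable.refl _⟩
    | @cons a c b h p ih =>
      intro ha
      obtain ⟨hb, hr⟩ := ih (SimpleGraph.Reachable.trans ha h.reachable)
      refine ⟨hb, SimpleGraph.Reachable.trans (SimpleGraph.Adj.reachable ?_) hr⟩
      exact (SimpleGraph.deleteEdges_le _ : D ≤ T) h
  have key' : ∀ b : farSide T x y,
      (T.induce (farSide T x y)).Reachable ⟨y, mem_farSide_self T x y⟩ b := by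
    rintro ⟨b, hb⟩
    obtain ⟨p⟩ := id hb
    exact (key _ _ p _).2
  have : Nonempty (farSide T x y) := ⟨⟨y, mem_farSide_self T x y⟩⟩
  exact ⟨fun a b ↦ (key' a).symm.trans (key' b)⟩

end Exchange

/-! ### Comparing a forest with a connected graph by counting edges -/

section Counting

theorem card_edgeSet_le_of_isAcyclic_of_connected {N : Type*} [Finite N] {X Y : SimpleGraph N}
    (hX : X.IsAcyclic) (hY : Y.Connected) : Nat.card X.edgeSet ≤ Nat.card Y.edgeSet := by
  have : Nonempty N := hY.nonempty
  obtain ⟨F, hF, -, hFt⟩ :=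
    SimpleGraph.connected_top.exists_isTree_le_of_le_of_isAcyclic (H := X) le_top hX
  have h1 := (SimpleGraph.isTree_iff_connected_and_card.1 hFt).2
  have h2 := hY.card_vert_le_card_edgeSet_add_one
  have h3 : Nat.card X.edgeSet ≤ Nat.card F.edgeSet :=
    Nat.card_mono (Set.toFinite _) (SimpleGraph.edgeSet_mono hF)
  omega

variable {V E : Type*}

-- Each edge inside `B` is counted at its violet end; the closure condition on `B` makes the full
-- violet degrees equal to those inside `B`.
open Classical in
theorem sum_ncard_neighborSet_eq [Fintype V] [Fintype E] {X : SimpleGraph (V ⊕ E)}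
    (hX : ∀ x y, X.Adj x y → (x.isLeft ∧ y.isRight) ∨ (x.isRight ∧ y.isLeft))
    (B : Set (V ⊕ E)) (hB : ∀ v y, Sum.inl v ∈ B → X.Adj (Sum.inl v) y → y ∈ B) :
    ∑ b : B with b.1.isLeft, (X.neighborSet b.1).ncard = Nat.card (X.induce B).edgeSet := by
  have hbip : (X.induce B).IsBipartiteWith
      ((Finset.univ.filter fun b : B ↦ b.1.isLeft : Finset B) : Set B)
      ((Finset.univ.filter fun b : B ↦ b.1.isRight : Finset B) : Set B) := by
    refine ⟨?_, fun x y h ↦ by simpa using hX _ _ h⟩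
    rw [Finset.disjoint_coe, Finset.disjoint_filter]
    rintro ⟨x | x, hx⟩ <;> simp
  rw [Nat.card_eq_fintype_card, ← SimpleGraph.edgeFinset_card,
    ← SimpleGraph.isBipartiteWith_sum_degrees_eq_card_edges hbip]
  refine Finset.sum_congr rfl fun b hb ↦ ?_
  rw [← SimpleGraph.card_neighborFinset_eq_degree, ← Set.ncard_coe_finset,
    SimpleGraph.coe_neighborFinset, ← Set.ncard_image_of_injective _ Subtype.val_injective]
  congr 1
  ext y
  obtain ⟨x | x, hx⟩ := b
  · constructor
    · exact fun hy ↦ ⟨⟨y, hB x y hx hy⟩, hy, rfl⟩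
    · rintro ⟨y, hy, rfl⟩
      exact hy
  · simp at hb

/-- On a set `B` that contains the neighbors of its violet nodes, a forest cannot have larger
violet degrees than a graph that is connected on `B`. -/
theorem ncard_neighborSet_eq_of_le [Finite V] [Finite E] {X Y : SimpleGraph (V ⊕ E)}
    (hX : ∀ x y, X.Adj x y → (x.isLeft ∧ y.isRight) ∨ (x.isRight ∧ y.isLeft))
    (hY : ∀ x y, Y.Adj x y → (x.isLeft ∧ y.isRight) ∨ (x.isRight ∧ y.isLeft))
    {B : Set (V ⊕ E)} (hBX : ∀ v y, Sum.inl v ∈ B → X.Adj (Sum.inl v) y → y ∈ B)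
    (hBY : ∀ v y, Sum.inl v ∈ B → Y.Adj (Sum.inl v) y → y ∈ B)
    (hXa : X.IsAcyclic) (hYc : (Y.induce B).Connected)
    (hle : ∀ v, Sum.inl v ∈ B →
      (Y.neighborSet (Sum.inl v)).ncard ≤ (X.neighborSet (Sum.inl v)).ncard)
    {w : V} (hw : Sum.inl w ∈ B) :
    (Y.neighborSet (Sum.inl w)).ncard = (X.neighborSet (Sum.inl w)).ncard := by
  classical
  have := Fintype.ofFinite V
  have := Fintype.ofFinite E
  have hcard := card_edgeSet_le_of_isAcyclic_of_connected (hXa.induce B) hYc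
  rw [← sum_ncard_neighborSet_eq hX B hBX, ← sum_ncard_neighborSet_eq hY B hBY] at hcard
  have hle' : ∀ b ∈ Finset.univ.filter (fun b : B ↦ b.1.isLeft),
      (Y.neighborSet b.1).ncard ≤ (X.neighborSet b.1).ncard := by
    rintro ⟨x | x, hx⟩ hb
    · exact hle x hx
    · simp at hb
  exact (Finset.sum_eq_sum_iff_of_le hle').1 (le_antisymm (Finset.sum_le_sum hle') hcard)
    ⟨Sum.inl w, hw⟩ (by simp)

end Counting

/-! ### Semi-passive edges and the violet matching -/

section SemiPassive

variable {N : Type*} {T : SimpleGraph N}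

theorem reachable_deleteEdges_iff (hT : T.IsTree) {x y a b : N} (h : T.Adj x y) :
    (T.deleteEdges {s(x, y)}).Reachable a b ↔ (a ∈ farSide T x y ↔ b ∈ farSide T x y) := by
  constructor
  · exact fun hab ↦ ⟨fun ha ↦ SimpleGraph.Reachable.trans ha hab,
      fun hb ↦ SimpleGraph.Reachable.trans hb hab.symm⟩
  · intro hab
    by_cases ha : a ∈ farSide T x y
    · exact SimpleGraph.Reachable.trans (SimpleGraph.Reachable.symm ha) (hab.1 ha)
    · have h1 := (mem_farSide_symm_iff hT h).2 ha
      have h2 := (mem_farSide_symm_iff hT h).2 (fun hb ↦ ha (hab.2 hb))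
      rw [farSide, Set.mem_ofPred_eq, Sym2.eq_swap] at h1 h2
      exact h1.symm.trans h2

/-- The pair before the first one at `x` is not at `x`, so it is a traversal into `x`, unless the
tour starts there. -/
theorem exists_tourPos_eq_zero_or_exists_adj [Finite N] {G : SimpleGraph N}
    {R : RibbonStructure G} {base : G.Dart} (hT : IsSpanningTree G T) {x y : N} (h : G.Adj x y) :
    (∃ z, G.Adj x z ∧ tourPos R base T x z = 0) ∨
      ∃ z, T.Adj z x ∧ tourPos R base T z x < tourPos R base T x z := by
  obtain ⟨z, hz, hmin⟩ := Set.exists_min_image (G.neighborSet x) (fun z ↦ tourPos R base T x z)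
    (Set.toFinite _) ⟨y, h⟩
  rcases Nat.eq_zero_or_pos (tourPos R base T x z) with h0 | h0
  · exact Or.inl ⟨z, hz, h0⟩
  · right
    obtain ⟨a, b, hab, hpos, ⟨hT', rfl⟩ | ⟨-, rfl⟩⟩ := exists_tourPos_add_one_eq hT hz h0
    · refine ⟨a, hT', ?_⟩
      have := hmin a hab.symm
      omega
    · have := hmin b hab
      omega

variable {V E : Type*} {G T : SimpleGraph (V ⊕ E)}

/-- Replacing a tree edge by another edge of its base cut: the resulting spanning tree. -/
theorem exists_isSpanningTree_exchange (hT : IsSpanningTree G T) {u v : V} {e f : E}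
    (h : T.Adj (Sum.inl u) (Sum.inr e)) (hvf : G.Adj (Sum.inl v) (Sum.inr f))
    (hv : Sum.inl v ∉ farSide T (Sum.inr e) (Sum.inl u))
    (hf : Sum.inr f ∈ farSide T (Sum.inr e) (Sum.inl u)) :
    ∃ T', IsSpanningTree G T' ∧ ∀ x y, T'.Adj x y ↔
      (T.Adj x y ∧ s(x, y) ≠ s(Sum.inl u, Sum.inr e)) ∨ s(x, y) = s(Sum.inl v, Sum.inr f) := by
  refine ⟨_, hT.exchange h.symm hvf hv hf, fun x y ↦ ?_⟩
  rw [SimpleGraph.sup_adj, SimpleGraph.deleteEdges_adj, SimpleGraph.edge_adj, Set.mem_singleton_iff,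
    Sym2.eq_swap (a := Sum.inr e), Sym2.eq_iff (z := Sum.inl v)]
  have : x = Sum.inl v ∧ y = Sum.inr f ∨ x = Sum.inr f ∧ y = Sum.inl v → x ≠ y := by
    rintro (⟨rfl, rfl⟩ | ⟨rfl, rfl⟩) <;> simp
  tauto

theorem not_adj_of_mem_farSide (hT : IsSpanningTree G T) {u v : V} {e f : E}
    (h : T.Adj (Sum.inl u) (Sum.inr e))
    (hv : Sum.inl v ∉ farSide T (Sum.inr e) (Sum.inl u))
    (hf : Sum.inr f ∈ farSide T (Sum.inr e) (Sum.inl u)) :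
    ¬ T.Adj (Sum.inl v) (Sum.inr f) := fun h' ↦ by
  simpa using eq_of_mem_farSide_of_notMem hT.2 h.symm h'.symm hf hv

variable [Finite V] [Finite E] {R : RibbonStructure G} {base : G.Dart}

theorem IsVCutJaegerTree.tourPos_lt (hJ : IsVCutJaegerTree R base T) {v : V} {e : E}
    (h : G.Adj (Sum.inl v) (Sum.inr e)) (h' : ¬ T.Adj (Sum.inl v) (Sum.inr e)) :
    tourPos R base T (Sum.inl v) (Sum.inr e) < tourPos R base T (Sum.inr e) (Sum.inl v) :=
  (tourLt_iff hJ.1 h h.symm).1 (hJ.2 v e h h')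

/-- In a Jaeger tree, the edges that lead back into a side which the tour enters through its violet
node are seen before that side is entered. -/
theorem IsVCutJaegerTree.tourPos_lt_of_mem_farSide (hJ : IsVCutJaegerTree R base T) {u v : V}
    {e f : E} (h : T.Adj (Sum.inl u) (Sum.inr e))
    (hlt : tourPos R base T (Sum.inr e) (Sum.inl u) < tourPos R base T (Sum.inl u) (Sum.inr e))
    (hvf : G.Adj (Sum.inl v) (Sum.inr f)) (hv : Sum.inl v ∉ farSide T (Sum.inr e) (Sum.inl u))
    (hf : Sum.inr f ∈ farSide T (Sum.inr e) (Sum.inl u)) :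
    tourPos R base T (Sum.inl v) (Sum.inr f) < tourPos R base T (Sum.inr e) (Sum.inl u) := by
  have hT : ¬ T.Adj (Sum.inl v) (Sum.inr f) := fun h' ↦ by
    simpa using eq_of_mem_farSide_of_notMem hJ.1.2 h.symm h'.symm hf hv
  have h1 := hJ.tourPos_lt hvf hT
  have h2 := (mem_farSide_iff hJ.1 h.symm hlt hvf.symm).1 hf
  have h3 := mt (mem_farSide_iff hJ.1 h.symm hlt hvf).2 hv
  have h4 : tourPos R base T (Sum.inl v) (Sum.inr f) ≠
      tourPos R base T (Sum.inr e) (Sum.inl u) := fun h' ↦ by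
    simpa using (tourPos_inj hJ.1 hvf (hJ.1.1 h).symm h').1
  omega

theorem IsVCutJaegerTree.isInternallySemiPassive_iff (hJ : IsVCutJaegerTree R base T) {u : V}
    {e : E} :
    IsInternallySemiPassive G T (VioletEdgeLt R base T) (u, e) ↔
      T.Adj (Sum.inl u) (Sum.inr e) ∧
      tourPos R base T (Sum.inr e) (Sum.inl u) < tourPos R base T (Sum.inl u) (Sum.inr e) ∧
      ∃ v f, G.Adj (Sum.inl v) (Sum.inr f) ∧ Sum.inl v ∉ farSide T (Sum.inr e) (Sum.inl u) ∧
        Sum.inr f ∈ farSide T (Sum.inr e) (Sum.inl u) := by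
  have hself := mem_farSide_self T (Sum.inr e) (Sum.inl u)
  have hswap : s((Sum.inl u : V ⊕ E), Sum.inr e) = s(Sum.inr e, Sum.inl u) := Sym2.eq_swap
  constructor
  · rintro ⟨h, ⟨v, f⟩, hcut, hmin, hopp⟩
    have he := notMem_farSide hJ.1.2 h.symm
    simp only [StandOpposite, hswap, reachable_deleteEdges_iff hJ.1.2 h.symm, hself, he,
      true_iff, false_iff] at hopp
    refine ⟨h, ?_, v, f, hcut.1, hopp.2, hopp.1⟩
    have hmem : (u, e) ∈ baseCut G T (u, e) := by
      refine ⟨hJ.1.1 h, ?_⟩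
      simp [hswap, reachable_deleteEdges_iff hJ.1.2 h.symm, hself, he]
    have hne : (u, e) ≠ (v, f) := by
      rintro ⟨⟩
      exact he hopp.1
    have h1 := (tourLt_iff hJ.1 hcut.1 (hJ.1.1 h)).1 (hmin _ hmem hne)
    by_contra hcon
    have hlt : tourPos R base T (Sum.inl u) (Sum.inr e) <
        tourPos R base T (Sum.inr e) (Sum.inl u) := by
      refine lt_of_le_of_ne (not_lt.1 hcon) fun h' ↦ ?_
      simpa using (tourPos_inj hJ.1 (hJ.1.1 h) (hJ.1.1 h).symm h').1
    -- If the edge were first traversed from `u` to `e`, then `v`, on the side of `e`, would be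
    -- visited only after `(u, ue)`, against minimality of `vf`.
    have h2 := (mem_farSide_iff hJ.1 h hlt hcut.1).1 ((mem_farSide_symm_iff hJ.1.2 h.symm).2 hopp.2)
    omega
  · rintro ⟨h, hlt, v, f, hvf, hv, hf⟩
    have he := notMem_farSide hJ.1.2 h.symm
    have hcut : ∀ q, q ∈ baseCut G T (u, e) ↔ G.Adj (Sum.inl q.1) (Sum.inr q.2) ∧
        ¬ (Sum.inl q.1 ∈ farSide T (Sum.inr e) (Sum.inl u) ↔
          Sum.inr q.2 ∈ farSide T (Sum.inr e) (Sum.inl u)) := by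
      intro q
      rw [← reachable_deleteEdges_iff hJ.1.2 h.symm, ← hswap]
      rfl
    obtain ⟨⟨w, g⟩, hq, hmin⟩ := Set.exists_min_image (baseCut G T (u, e))
      (fun q ↦ tourPos R base T (Sum.inl q.1) (Sum.inr q.2)) (Set.toFinite _)
      ⟨(v, f), (hcut _).2 ⟨hvf, by simp [hv, hf]⟩⟩
    have h1 := hJ.tourPos_lt_of_mem_farSide h hlt hvf hv hf
    have h2 := hmin (v, f) ((hcut _).2 ⟨hvf, by simp [hv, hf]⟩)
    dsimp only at h2
    -- The edge `vf` is seen before this side is entered, so the violet end of the minimum cannot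
    -- lie inside.
    have hw : Sum.inl w ∉ farSide T (Sum.inr e) (Sum.inl u) := fun hw ↦ by
      have := (mem_farSide_iff hJ.1 h.symm hlt ((hcut _).1 hq).1).1 hw
      dsimp only at this
      omega
    have hg : Sum.inr g ∈ farSide T (Sum.inr e) (Sum.inl u) := by
      have := ((hcut _).1 hq).2
      tauto
    refine ⟨h, (w, g), hq, fun q' hq' hne ↦ ?_, ?_⟩
    · have hG := ((hcut _).1 hq).1
      have hG' := ((hcut _).1 hq').1
      refine (tourLt_iff hJ.1 hG hG').2 (lt_of_le_of_ne (hmin q' hq') fun h' ↦ hne ?_)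
      have := tourPos_inj hJ.1 hG hG' h'
      simp only [Sum.inl.injEq, Sum.inr.injEq] at this
      exact Prod.ext this.1.symm this.2.symm
    · simp [StandOpposite, hswap, reachable_deleteEdges_iff hJ.1.2 h.symm, hself, he, hw, hg]

theorem mem_internallyInactive_iff {M A : Type*} {G : SimpleGraph M} {ι : A → M}
    {lt : A → A → Prop} {f : A → ℕ} {a : A} :
    a ∈ internallyInactive G ι lt f ↔ ∃ b, lt b a ∧ CanTransfer G ι f a b := by
  simp [internallyInactive, IsInternallyActive]

theorem IsVCutJaegerTree.bijOn_fst (hJ : IsVCutJaegerTree R base T)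
    (hG : ∀ x y, G.Adj x y → (x.isLeft ∧ y.isRight) ∨ (x.isRight ∧ y.isLeft)) :
    Set.BijOn Prod.fst {p : V × E | IsInternallySemiPassive G T (VioletEdgeLt R base T) p}
      (internallyInactive G Sum.inl (VioletLtOnV R base T) (inducedHypertree Sum.inl T)) := by
  have hT := hJ.1
  refine ⟨?_, ?_, ?_⟩
  · rintro ⟨u, e⟩ hp
    obtain ⟨h, hlt, v, f, hvf, hv, hf⟩ := hJ.isInternallySemiPassive_iff.1 hp
    refine mem_internallyInactive_iff.2 ⟨v, ⟨f, hvf, fun g hg ↦ ?_⟩, ?_⟩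
    · refine (tourLt_iff hT hvf hg).2 ?_
      have h1 := hJ.tourPos_lt_of_mem_farSide h hlt hvf hv hf
      have h2 := (mem_farSide_iff hT h.symm hlt hg).1 (mem_farSide_self _ _ _)
      dsimp only at h2 ⊢
      omega
    · obtain ⟨T', hT', hadj⟩ := exists_isSpanningTree_exchange hT h hvf hv hf
      refine canTransfer_of_exchange Sum.inl_injective hT hT' ?_ (by simp) (by simp) h
        (not_adj_of_mem_farSide hT h hv hf) hadj
      rintro rfl
      exact hv (mem_farSide_self _ _ _)
  · rintro ⟨u, e⟩ hp ⟨u', e'⟩ hp' rfl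
    obtain ⟨h, hlt, -⟩ := hJ.isInternallySemiPassive_iff.1 hp
    obtain ⟨h', hlt', -⟩ := hJ.isInternallySemiPassive_iff.1 hp'
    by_contra hne
    have := tourPos_lt_of_ne hT h.symm h'.symm (by simpa using hne) hlt
    dsimp only at hlt'
    omega
  · intro u hu
    obtain ⟨w, ⟨f, hwf, hlt⟩, g, ⟨T', hT', hdeg⟩, hgu, hgw, hg⟩ :=
      mem_internallyInactive_iff.1 hu
    have hlt' : ∀ e', G.Adj (Sum.inl u) (Sum.inr e') → tourPos R base T (Sum.inl w) (Sum.inr f) <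
        tourPos R base T (Sum.inl u) (Sum.inr e') := fun e' he' ↦
      (tourLt_iff hT hwf he').1 (hlt e' he')
    have hright : ∀ v z, G.Adj (Sum.inl v) z → ∃ e : E, z = Sum.inr e := by
      rintro v (z | z) hz
      · simpa using hG _ _ hz
      · exact ⟨z, rfl⟩
    have : Nontrivial (V ⊕ E) := ⟨_, _, hwf.ne⟩
    obtain ⟨y, hy⟩ := hT.2.connected.preconnected.exists_adj_of_nontrivial (Sum.inl u)
    rcases exists_tourPos_eq_zero_or_exists_adj (R := R) (base := base) hT (hT.1 hy) with
      ⟨z, hz, h0⟩ | ⟨z, hz, hparent⟩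
    · obtain ⟨e', rfl⟩ := hright u z hz
      have := hlt' e' hz
      omega
    obtain ⟨e, rfl⟩ := hright u z (hT.1 hz).symm
    refine ⟨(u, e), hJ.isInternallySemiPassive_iff.2 ⟨hz.symm, hparent, ?_⟩, rfl⟩
    by_contra! hcon
    -- The pair right after entering this side is at `u`, and `(w, wf)` precedes every pair at `u`.
    have hw : Sum.inl w ∉ farSide T (Sum.inr e) (Sum.inl u) := by
      intro hw
      have h1 := (mem_farSide_iff hT hz hparent hwf).1 hw
      obtain ⟨y, hy, hy', -⟩ := exists_tourPos_eq_add_one (R := R) (base := base) hT hz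
        (by have := RibbonTour.tourPos_lt (R := R) (base := base) hT (hT.1 hz).symm; omega)
      obtain ⟨e', rfl⟩ := hright u y hy
      have := hlt' e' hy
      omega
    have hB : ∀ v y, Sum.inl v ∈ farSide T (Sum.inl u) (Sum.inr e) → G.Adj (Sum.inl v) y →
        y ∈ farSide T (Sum.inl u) (Sum.inr e) := by
      intro v y hv hvy
      obtain ⟨e', rfl⟩ := hright v y hvy
      rw [mem_farSide_symm_iff hT.2 hz] at hv ⊢
      exact hcon v e' hvy hv
    have hpos := hT.neighborSet_ncard_pos
    have hfw : g w = (T.neighborSet (Sum.inl w)).ncard - 1 + 1 := hgw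
    have hdw := hdeg w
    -- The only violet degree that drops is that of `u`, which lies outside the counted side; the
    -- degree of `w` rises, so equality is impossible.
    have := ncard_neighborSet_eq_of_le (X := T') (Y := T) (fun x y h ↦ hG x y (hT'.1 h))
      (fun x y h ↦ hG x y (hT.1 h)) (fun v y hv h ↦ hB v y hv (hT'.1 h))
      (fun v y hv h ↦ hB v y hv (hT.1 h)) hT'.2.isAcyclic (connected_induce_farSide _ _ _) (by
        intro v hv
        have hdv := hdeg v
        by_cases hvw : v = w
        · subst hvw
          omega
        · have hgv : g v = (T.neighborSet (Sum.inl v)).ncard - 1 := by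
            refine hg v ?_ hvw
            rintro rfl
            exact notMem_farSide hT.2 hz.symm hv
          omega) ((mem_farSide_symm_iff hT.2 hz).2 hw)
    have := hpos (Sum.inl w)
    omega

end SemiPassive

/-! ### Emerald nodes of degree two and the emerald matching -/

section DegreeTwo

theorem ncard_pair_le_two {α : Type*} (a b : α) : ({a, b} : Set α).ncard ≤ 2 := by
  simpa using Set.ncard_insert_le a {b}

variable {V E : Type*} {G T : SimpleGraph (V ⊕ E)}

theorem neighborSet_inr_subset_pair (hT : T ≤ G)
    (hG : ∀ x y, G.Adj x y → (x.isLeft ∧ y.isRight) ∨ (x.isRight ∧ y.isLeft)) {e : E} {a b : V}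
    (hab : ∀ v, G.Adj (Sum.inl v) (Sum.inr e) → v = a ∨ v = b) :
    T.neighborSet (Sum.inr e) ⊆ {Sum.inl a, Sum.inl b} := by
  rintro (v | f) hv
  · simpa using hab v (hT hv).symm
  · simpa using hG _ _ (hT hv)

theorem adj_of_two_le_ncard (hT : T ≤ G)
    (hG : ∀ x y, G.Adj x y → (x.isLeft ∧ y.isRight) ∨ (x.isRight ∧ y.isLeft)) {e : E} {a b : V}
    (hab : ∀ v, G.Adj (Sum.inl v) (Sum.inr e) → v = a ∨ v = b)
    (h : 2 ≤ (T.neighborSet (Sum.inr e)).ncard) {v : V} (hv : G.Adj (Sum.inl v) (Sum.inr e)) :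
    T.Adj (Sum.inl v) (Sum.inr e) := by
  have hsub := neighborSet_inr_subset_pair hT hG hab
  have heq := Set.eq_of_subset_of_ncard_le hsub ((ncard_pair_le_two _ _).trans h)
  have : Sum.inl v ∈ T.neighborSet (Sum.inr e) := by
    rw [heq]
    simpa using hab v hv
  exact SimpleGraph.Adj.symm this

/-- In a connected graph, a set of violet nodes that contains, with one neighbor of an emerald node,
all of its neighbors, is everything once it is non-empty. -/
theorem mem_of_connected_of_forall_adj (hT : T.Connected)
    (hG : ∀ x y, T.Adj x y → (x.isLeft ∧ y.isRight) ∨ (x.isRight ∧ y.isLeft)) {K : Set V}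
    (hK : ∀ e x y, T.Adj (Sum.inl x) (Sum.inr e) → T.Adj (Sum.inl y) (Sum.inr e) → x ∈ K → y ∈ K)
    {u v : V} (hu : u ∈ K) : v ∈ K := by
  let Q : V ⊕ E → Prop :=
    Sum.elim (fun x ↦ x ∈ K) (fun e ↦ ∃ x, T.Adj (Sum.inl x) (Sum.inr e) ∧ x ∈ K)
  have key : ∀ (a b : V ⊕ E) (_ : T.Walk a b), Q a → Q b := by
    intro a b p
    induction p with
    | nil => exact id
    | @cons a c b h p ih =>
      refine fun ha ↦ ih ?_
      rcases a with a | a <;> rcases c with c | c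
      · simpa using hG _ _ h
      · exact ⟨a, h, ha⟩
      · obtain ⟨x, hx, hxK⟩ := ha
        exact hK a x c hx h.symm hxK
      · simpa using hG _ _ h
  obtain ⟨p⟩ := hT.preconnected (Sum.inl u) (Sum.inl v)
  exact key _ _ p hu

variable [Finite V] [Finite E] {R : RibbonStructure G} {base : G.Dart}

/-- With both edges at `e` in `T`, nothing is skipped at `e`, so `(e, eu)` follows an arrival at
`e`; arriving from `u` would be too late. -/
theorem tourPos_add_one_eq (hT : IsSpanningTree G T)
    (hG : ∀ x y, G.Adj x y → (x.isLeft ∧ y.isRight) ∨ (x.isRight ∧ y.isLeft)) {e : E} {u v : V}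
    (huv : ∀ w, G.Adj (Sum.inl w) (Sum.inr e) → w = u ∨ w = v) (hu : T.Adj (Sum.inl u) (Sum.inr e))
    (hv : T.Adj (Sum.inl v) (Sum.inr e))
    (hlt : tourPos R base T (Sum.inr e) (Sum.inl u) < tourPos R base T (Sum.inl u) (Sum.inr e))
    (hpos : 0 < tourPos R base T (Sum.inr e) (Sum.inl u)) :
    tourPos R base T (Sum.inl v) (Sum.inr e) + 1 = tourPos R base T (Sum.inr e) (Sum.inl u) := by
  obtain ⟨a, b, hab, hadd, ⟨hT', rfl⟩ | ⟨hT', rfl⟩⟩ :=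
    exists_tourPos_add_one_eq hT (hT.1 hu).symm hpos
  · have := neighborSet_inr_subset_pair hT.1 hG huv hT'.symm
    rcases this with rfl | rfl
    · omega
    · exact hadd
  · have := neighborSet_inr_subset_pair le_rfl hG huv hab
    rcases this with rfl | rfl
    · exact absurd hu.symm hT'
    · exact absurd hv.symm hT'

theorem IsVCutJaegerTree.tourPos_lt_of_isInternallySemiPassive (hJ : IsVCutJaegerTree R base T)
    (hG : ∀ x y, G.Adj x y → (x.isLeft ∧ y.isRight) ∨ (x.isRight ∧ y.isLeft)) {e : E} {u v : V}
    (huv : ∀ w, G.Adj (Sum.inl w) (Sum.inr e) → w = u ∨ w = v)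
    (hp : IsInternallySemiPassive G T (VioletEdgeLt R base T) (u, e))
    (hv : T.Adj (Sum.inl v) (Sum.inr e)) :
    tourPos R base T (Sum.inl v) (Sum.inr e) + 1 = tourPos R base T (Sum.inr e) (Sum.inl u) := by
  obtain ⟨h, hlt, w, f, hwf, hw, hf⟩ := hJ.isInternallySemiPassive_iff.1 hp
  -- Something precedes `(e, eu)`, so it is not the base pair.
  have := hJ.tourPos_lt_of_mem_farSide h hlt hwf hw hf
  exact tourPos_add_one_eq hJ.1 hG huv h hv hlt (by omega)

theorem IsVCutJaegerTree.bijOn_snd (hJ : IsVCutJaegerTree R base T)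
    (hG : ∀ x y, G.Adj x y → (x.isLeft ∧ y.isRight) ∨ (x.isRight ∧ y.isLeft))
    (hdeg : ∀ v e, G.Adj (Sum.inl v) (Sum.inr e) → ∃ v', v' ≠ v ∧ G.Adj (Sum.inl v') (Sum.inr e) ∧
      ∀ w, G.Adj (Sum.inl w) (Sum.inr e) → w = v ∨ w = v') :
    Set.BijOn Prod.snd {p : V × E | IsInternallySemiPassive G T (VioletEdgeLt R base T) p}
      (internallyInactive G Sum.inr (VioletLtOnE R base T) (inducedHypertree Sum.inr T)) := by
  have hT := hJ.1
  refine ⟨?_, ?_, ?_⟩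
  · rintro ⟨u, e⟩ hp
    obtain ⟨h, hlt, w, f, hwf, hw, hf⟩ := hJ.isInternallySemiPassive_iff.1 hp
    have hne : e ≠ f := by
      rintro rfl
      exact notMem_farSide hT.2 h.symm hf
    have hwe := hJ.tourPos_lt_of_mem_farSide h hlt hwf hw hf
    refine mem_internallyInactive_iff.2 ⟨f, ⟨w, hwf, fun v hv ↦ ?_⟩, ?_⟩
    · dsimp only at hv ⊢
      refine (tourLt_iff hT hwf hv).2 ?_
      by_cases hvu : v = u
      · subst hvu
        omega
      obtain ⟨v', hv'u, hv', huv'⟩ := hdeg u e (hT.1 h)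
      obtain rfl : v = v' := (huv' v hv).resolve_left hvu
      -- The node `w` is joined to `e` in `T - ue`, so `e` has a second tree edge, necessarily the
      -- one to `v`.
      have hvT : T.Adj (Sum.inl v) (Sum.inr e) := by
        obtain ⟨p⟩ := (mem_farSide_symm_iff hT.2 h.symm).2 hw
        cases p with
        | @cons _ c _ hc p =>
          rw [SimpleGraph.deleteEdges_adj] at hc
          have hmem := neighborSet_inr_subset_pair hT.1 hG huv' hc.1
          rcases hmem with rfl | rfl
          · exact absurd Sym2.eq_swap hc.2
          · exact hc.1.symm
      have h1 := hJ.tourPos_lt_of_isInternallySemiPassive hG huv' hp hvT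
      have h2 : tourPos R base T (Sum.inl w) (Sum.inr f) ≠
          tourPos R base T (Sum.inl v) (Sum.inr e) := fun h' ↦
        hne (Sum.inr_injective (tourPos_inj hT hwf hv h').2).symm
      omega
    · obtain ⟨T', hT', hadj⟩ := exists_isSpanningTree_exchange hT h hwf hw hf
      refine canTransfer_of_exchange Sum.inr_injective hT hT' hne (m := Sum.inl u) (n := Sum.inl w)
        (by simp) (by simp) h.symm
        (fun h' ↦ not_adj_of_mem_farSide hT h hw hf h'.symm) fun x y ↦ ?_
      rw [hadj, Sym2.eq_swap (a := Sum.inl u), Sym2.eq_swap (a := Sum.inl w)]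
  · rintro ⟨u, e⟩ hp ⟨v, e'⟩ hp' rfl
    obtain ⟨h, hlt, -⟩ := hJ.isInternallySemiPassive_iff.1 hp
    obtain ⟨h', hlt', -⟩ := hJ.isInternallySemiPassive_iff.1 hp'
    by_contra hne
    have hvu : v ≠ u := by
      rintro rfl
      exact hne rfl
    dsimp only at h' hlt'
    obtain ⟨v', hv'u, hv', huv'⟩ := hdeg u e (hT.1 h)
    obtain rfl : v = v' := (huv' v (hT.1 h')).resolve_left hvu
    have h1 := hJ.tourPos_lt_of_isInternallySemiPassive hG huv' hp h'
    have h2 := hJ.tourPos_lt_of_isInternallySemiPassive hG (fun w hw ↦ (huv' w hw).symm) hp' h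
    omega
  · intro e he
    obtain ⟨f, ⟨w, hwf, hlt⟩, g, ⟨T', hT', hdeg'⟩, hge, hgf, hg⟩ :=
      mem_internallyInactive_iff.1 he
    have : Nontrivial (V ⊕ E) := ⟨_, _, hwf.ne⟩
    have hpos := hT.neighborSet_ncard_pos
    have hge : g e + 1 = (T.neighborSet (Sum.inr e)).ncard - 1 := hge
    have hne : f ≠ e := by
      rintro rfl
      omega
    obtain ⟨a, ha⟩ : ∃ a, G.Adj (Sum.inl a) (Sum.inr e) := by
      obtain ⟨a | a, ha⟩ := hT.2.connected.preconnected.exists_adj_of_nontrivial (Sum.inr e)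
      · exact ⟨a, (hT.1 ha).symm⟩
      · simpa using hG _ _ (hT.1 ha)
    obtain ⟨b, hba, hb, hab⟩ := hdeg a e ha
    have hfull : ∀ v, G.Adj (Sum.inl v) (Sum.inr e) → T.Adj (Sum.inl v) (Sum.inr e) := fun v hv ↦
      adj_of_two_le_ncard hT.1 hG hab (by omega) hv
    have htwo : (T.neighborSet (Sum.inr e)).ncard ≤ 2 :=
      (Set.ncard_le_ncard (neighborSet_inr_subset_pair hT.1 hG hab)).trans (ncard_pair_le_two _ _)
    have hab' := fun w hw ↦ (hab w hw).symm
    -- The node `u` is the end of `e` by which the tour first leaves `e`. If both edges are first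
    -- traversed away from `e`, the later one is chosen, so that its time is positive.
    obtain ⟨u, v, hvu, hu, hv, huv, hup, hpu⟩ : ∃ u v, v ≠ u ∧ T.Adj (Sum.inl u) (Sum.inr e) ∧
        T.Adj (Sum.inl v) (Sum.inr e) ∧ (∀ w, G.Adj (Sum.inl w) (Sum.inr e) → w = u ∨ w = v) ∧
        tourPos R base T (Sum.inr e) (Sum.inl u) < tourPos R base T (Sum.inl u) (Sum.inr e) ∧
        0 < tourPos R base T (Sum.inr e) (Sum.inl u) := by
      have hTa := hfull a ha
      have hTb := hfull b hb
      have hself := fun v ↦ mem_farSide_self T (Sum.inl v) (Sum.inr e)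
      rcases lt_or_gt_of_ne (show tourPos R base T (Sum.inl a) (Sum.inr e) ≠
        tourPos R base T (Sum.inr e) (Sum.inl a) from fun h ↦ by
          simpa using (tourPos_inj hT ha ha.symm h).1) with h1 | h1
      · have h3 := tourPos_lt_of_ne hT hTa hTb (by simpa using hba.symm) h1
        have h4 := (mem_farSide_iff hT hTa h1 hb.symm).1 (hself a)
        exact ⟨b, a, hba.symm, hTb, hTa, hab', h3, by omega⟩
      rcases lt_or_gt_of_ne (show tourPos R base T (Sum.inl b) (Sum.inr e) ≠
        tourPos R base T (Sum.inr e) (Sum.inl b) from fun h ↦ by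
          simpa using (tourPos_inj hT hb hb.symm h).1) with h2 | h2
      · have h4 := (mem_farSide_iff hT hTb h2 ha.symm).1 (hself b)
        exact ⟨a, b, hba, hTa, hTb, hab, h1, by omega⟩
      rcases lt_or_gt_of_ne (show tourPos R base T (Sum.inr e) (Sum.inl a) ≠
        tourPos R base T (Sum.inr e) (Sum.inl b) from fun h ↦ by
          simpa [hba.symm] using (tourPos_inj hT ha.symm hb.symm h).2) with h3 | h3
      · exact ⟨b, a, hba.symm, hTb, hTa, hab', h2, by omega⟩
      · exact ⟨a, b, hba, hTa, hTb, hab, h1, by omega⟩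
    have hpred := tourPos_add_one_eq hT hG huv hu hv hup hpu
    refine ⟨(u, e), hJ.isInternallySemiPassive_iff.2 ⟨hu, hup, ?_⟩, rfl⟩
    by_contra! hcon
    have hlt' := (tourLt_iff hT hwf (hT.1 hv)).1 (hlt v (hT.1 hv))
    have hw : Sum.inl w ∉ farSide T (Sum.inr e) (Sum.inl u) := fun hw ↦ by
      have := (mem_farSide_iff hT hu.symm hup hwf).1 hw
      omega
    have hsame : ∀ {e' : E} {x : V}, e' ≠ e → T.Adj (Sum.inl x) (Sum.inr e') →
        (Sum.inl x ∈ farSide T (Sum.inr e) (Sum.inl u) ↔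
          Sum.inr e' ∈ farSide T (Sum.inr e) (Sum.inl u)) := fun he' hx ↦
      mem_farSide_iff_of_adj hx (by simp [he'])
    obtain ⟨w', hw'w, hw'f, hww'⟩ := hdeg w f hwf
    -- Otherwise `f` would hang on `w` alone, and `(f, fw')` would come right after `(w, wf)`,
    -- before the side of `u` is entered. By the Jaeger condition `(w', w'f)` would come earlier
    -- still, although `w'` lies on that side.
    have hw' : Sum.inl w' ∉ farSide T (Sum.inr e) (Sum.inl u) := by
      intro hw'
      have hw'T : ¬ T.Adj (Sum.inl w') (Sum.inr f) := fun h ↦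
        hcon w f hwf hw ((hsame hne h).1 hw')
      have hwT : T.Adj (Sum.inl w) (Sum.inr f) := by
        obtain ⟨x, hx⟩ := hT.2.connected.preconnected.exists_adj_of_nontrivial (Sum.inr f)
        rcases neighborSet_inr_subset_pair hT.1 hG hww' hx with rfl | rfl
        · exact hx.symm
        · exact absurd hx.symm hw'T
      obtain ⟨z, hz, hz', hzw⟩ := exists_tourPos_eq_add_one (R := R) (base := base) hT hwT
        (by have := RibbonTour.tourPos_lt (R := R) (base := base) hT (hT.1 hu).symm; omega)
      have hzw := hzw _ hw'f.symm (by simpa using hw'w)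
      rcases neighborSet_inr_subset_pair le_rfl hG hww' hz with rfl | rfl
      · exact hzw rfl
      · have h1 := hJ.tourPos_lt hw'f hw'T
        have h2 := (mem_farSide_iff hT hu.symm hup hw'f).1 hw'
        omega
    -- No emerald node leads `T'` out of this side: `e` is a leaf of `T'`, both ends of `f` are
    -- outside, and any other node of degree two in `T'` has the same two edges in `T`.
    have hvK : Sum.inl v ∈ farSide T (Sum.inr e) (Sum.inl u) := by
      refine mem_of_connected_of_forall_adj (K := {x | Sum.inl x ∈ farSide T (Sum.inr e) (Sum.inl u)})
        hT'.2.connected (fun x y h ↦ hG x y (hT'.1 h)) ?_ (u := u) (mem_farSide_self _ _ _)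
      intro e' x y hx hy hxK
      by_cases hxy : x = y
      · rwa [← hxy]
      have h2 : 1 < (T'.neighborSet (Sum.inr e')).ncard :=
        (Set.one_lt_ncard (Set.toFinite _)).2
          ⟨_, hx.symm, _, hy.symm, by simpa using hxy⟩
      have hde := hdeg' e'
      by_cases he'e : e' = e
      · subst he'e
        omega
      by_cases he'f : e' = f
      · subst he'f
        rcases hww' x (hT'.1 hx) with rfl | rfl
        · exact absurd hxK hw
        · exact absurd hxK hw'
      have hge' : g e' = (T.neighborSet (Sum.inr e')).ncard - 1 := hg e' he'e he'f
      obtain ⟨x', -, -, hx'⟩ := hdeg x e' (hT'.1 hx)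
      have hadj := fun z (hz : G.Adj (Sum.inl z) (Sum.inr e')) ↦
        adj_of_two_le_ncard hT.1 hG hx' (by omega) hz
      exact (hsame he'e (hadj y (hT'.1 hy))).2 ((hsame he'e (hadj x (hT'.1 hx))).1 hxK)
    exact notMem_farSide hT.2 hu.symm ((mem_farSide_iff_of_adj hv (by simp [hvu])).1 hvK)

end DegreeTwo

/-! ### Specialization to the bipartite graph of a graph -/

section Graph

variable {V E : Type*} {H : MultiHypergraph V E}

theorem MultiHypergraph.bip_adj_inl_inr {v : V} {e : E} :
    H.bip.Adj (Sum.inl v) (Sum.inr e) ↔ v ∈ H.hyperedge e := by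
  simp [MultiHypergraph.bip]

theorem MultiHypergraph.isLeft_and_isRight_of_bip_adj {x y : V ⊕ E} (h : H.bip.Adj x y) :
    (x.isLeft ∧ y.isRight) ∨ (x.isRight ∧ y.isLeft) := by
  rcases h with ⟨v, e, -, rfl, rfl⟩ | ⟨v, e, -, rfl, rfl⟩ <;> simp

theorem MultiHypergraph.IsGraph.exists_ne_adj (hH : H.IsGraph) {v : V} {e : E}
    (h : H.bip.Adj (Sum.inl v) (Sum.inr e)) :
    ∃ v', v' ≠ v ∧ H.bip.Adj (Sum.inl v') (Sum.inr e) ∧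
      ∀ w, H.bip.Adj (Sum.inl w) (Sum.inr e) → w = v ∨ w = v' := by
  classical
  simp only [MultiHypergraph.bip_adj_inl_inr] at h ⊢
  obtain ⟨a, b, hab, he⟩ := Finset.card_eq_two.1 (hH e)
  rw [he] at h ⊢
  simp only [Finset.mem_insert, Finset.mem_singleton] at h ⊢
  rcases h with rfl | rfl
  · exact ⟨b, hab.symm, Or.inr rfl, fun w hw ↦ hw⟩
  · exact ⟨a, hab, Or.inl rfl, fun w hw ↦ hw.symm⟩

end Graph

end RibbonTour

/-- The internally semi-passive edges (all with respect to the violet `T`-orders) form a perfect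
matching between the internally inactive elements of `V` and those of `E`: sending such an edge to
its violet, resp. emerald, endpoint is a bijection onto the inactive elements of `V`, resp. `E`. -/
theorem mainTheorem8 {V E : Type*} [Finite V] [Finite E]
    (H : RibbonTour.MultiHypergraph V E) (hH : H.IsGraph)
    (R : RibbonTour.RibbonStructure H.bip) (base : H.bip.Dart)
    (T : SimpleGraph (V ⊕ E)) (hT : RibbonTour.IsVCutJaegerTree R base T) :
    Set.BijOn Prod.fst
      {p : V × E | RibbonTour.IsInternallySemiPassive H.bip T
        (RibbonTour.VioletEdgeLt R base T) p}
      (RibbonTour.internallyInactive H.bip Sum.inl (RibbonTour.VioletLtOnV R base T)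
        (RibbonTour.inducedHypertree Sum.inl T)) ∧
    Set.BijOn Prod.snd
      {p : V × E | RibbonTour.IsInternallySemiPassive H.bip T
        (RibbonTour.VioletEdgeLt R base T) p}
      (RibbonTour.internallyInactive H.bip Sum.inr (RibbonTour.VioletLtOnE R base T)
        (RibbonTour.inducedHypertree Sum.inr T)) :=
  ⟨hT.bijOn_fst fun _ _ ↦ RibbonTour.MultiHypergraph.isLeft_and_isRight_of_bip_adj,
    hT.bijOn_snd (fun _ _ ↦ RibbonTour.MultiHypergraph.isLeft_and_isRight_of_bip_adj)
      fun _ _ ↦ hH.exists_ne_adj⟩
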